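/- Let $(\mathcal{A},\mathbb{E},\mathfrak{s})$ be an extriangulated category in the sense of Nakaoka and Palu. Subcategories are full, non-empty and closed under isomorphisms. A \emph{length function} is a map $\Theta$ from isomorphism classes of objects of $\mathcal{A}$ to $\mathbb{N}$ such that $\Theta(X)=0$ if and only if $X\cong 0$, and $\Theta(L)\le\Theta(X)+\Theta(M)$ for every $\mathbb{E}$-triangle $X\to L\to M\overset{\delta}{\dashrightarrow}$, with equality if $\delta=0$. An $\mathbb{E}$-triangle $X\xrightarrow{x}L\xrightarrow{y}M\dashrightarrow$ is \emph{$\Theta$-stable} if $\Theta(L)=\Theta(X)+\Theta(M)$; then $x$ is called a \emph{$\Theta$-inflation} with cone $M$, and $y$ a \emph{$\Theta$-deflation}. Assume that $(\mathcal{A},\Theta)$ is an \emph{extriangulated length category}: $\Theta$ is a length function and every morphism $f$ of $\mathcal{A}$ factors as $f=j\circ i$ with $i$ a $\Theta$-deflation and $j$ a $\Theta$-inflation. A \emph{torsion class} is a subcategory $\mathcal{T}$ such that $M\in\mathcal{T}$ whenever there is a $\Theta$-deflation $T\to M$ with $T\in\mathcal{T}$, and such that $M\in\mathcal{T}$ whenever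 there is a $\Theta$-stable $\mathbb{E}$-triangle $T\to M\to T'\dashrightarrow$ with $T,T'\in\mathcal{T}$. A \emph{torsion-free class} is a subcategory $\mathcal{F}$ such that $M\in\mathcal{F}$ whenever there is a $\Theta$-inflation $M\to F$ with $F\in\mathcal{F}$, and such that $M\in\mathcal{F}$ whenever there is a $\Theta$-stable $\mathbb{E}$-triangle $F\to M\to F'\dashrightarrow$ with $F,F'\in\mathcal{F}$. Let $\mathrm{tors}_\Theta(\mathcal{A})$ and $\mathrm{torf}_\Theta(\mathcal{A})$ be the sets of torsion classes and of torsion-free classes, ordered by inclusion. For a class $\mathcal{X}$ of objects put $\mathcal{X}^{\perp}=\{M\mid \mathrm{Hom}(X,M)=0\ \forall X\in\mathcal{X}\}$ and ${}^{\perp}\mathcal{X}=\{M\mid \mathrm{Hom}(M,X)=0\ \forall X\in\mathcal{X}\}$, and let $\mathrm{Filt}_\Theta(\mathcal{X})$ consist of the objects $M$ that admit a finite chain $0=M_0\to M_1\to\cdots\to M_n=M$ ($n\ge 0$) of $\Theta$-inflations with cones in $\mathcal{X}$. Then: (1) $\mathrm{tors}_\Theta(\mathcal{A})$ is a complete lattice,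 and for every subset $\mathcal{L}$ of it $$\bigvee\mathcal{L}={}^{\perp}\Bigl(\bigcap_{\mathcal{T}\in\mathcal{L}}\mathcal{T}^{\perp}\Bigr)=\mathrm{Filt}_\Theta\Bigl(\bigcup_{\mathcal{T}\in\mathcal{L}}\mathcal{T}\Bigr),\qquad \bigwedge\mathcal{L}=\bigcap_{\mathcal{T}\in\mathcal{L}}\mathcal{T}.$$ (2) $\mathrm{torf}_\Theta(\mathcal{A})$ is a complete lattice, and for every subset $\mathcal{L}'$ of it $$\bigvee\mathcal{L}'=\Bigl(\bigcap_{\mathcal{F}\in\mathcal{L}'}{}^{\perp}\mathcal{F}\Bigr)^{\perp}=\mathrm{Filt}_\Theta\Bigl(\bigcup_{\mathcal{F}\in\mathcal{L}'}\mathcal{F}\Bigr),\qquad \bigwedge\mathcal{L}'=\bigcap_{\mathcal{F}\in\mathcal{L}'}\mathcal{F}.$$ (3) $\mathcal{T}\mapsto\mathcal{T}^{\perp}$ is an isomorphism of complete lattices $\mathrm{tors}_\Theta(\mathcal{A})\to\mathrm{torf}_\Theta(\mathcal{A})^{\mathrm{op}}$. (4) $P=\mathrm{tors}_\Theta(\mathcal{A})$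 is completely semidistributive: for all $x\in P$ and $L\subseteq P$, if $x\wedge y=x\wedge z$ for all $y,z\in L$, then $x\wedge\bigvee L=x\wedge y$ for all $y\in L$; and if $x\vee y=x\vee z$ for all $y,z\in L$, then $x\vee\bigwedge L=x\vee y$ for all $y\in L$. (5) $\mathrm{tors}_\Theta(\mathcal{A})$ is algebraic: each of its elements is a join of compact elements, where $c$ is compact if $c\le\bigvee L$ always implies $c\le\bigvee S$ for some finite $S\subseteq L$. -/

import Mathlib

open CategoryTheory CategoryTheory.Limits Opposite

universe w v u

namespace Extri

/-! ### Extensions for an additive bifunctor -/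

section Bifunctor

variable {C : Type u} [Category.{v} C]

/-- The abelian group `𝔼(Z, X)`. -/
abbrev Extn (F : Cᵒᵖ ⥤ C ⥤ AddCommGrpCat.{w}) (Z X : C) : Type w :=
  ((F.obj (op Z)).obj X : Type w)

/-- `a_* : 𝔼(Z, X) → 𝔼(Z, X')` for `a : X ⟶ X'`. -/
def push (F : Cᵒᵖ ⥤ C ⥤ AddCommGrpCat.{w}) {Z X X' : C} (a : X ⟶ X') :
    Extn F Z X →+ Extn F Z X' :=
  ((F.obj (op Z)).map a).hom

/-- `c^* : 𝔼(Z, X) → 𝔼(Z', X)` for `c : Z' ⟶ Z`. -/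
def pull (F : Cᵒᵖ ⥤ C ⥤ AddCommGrpCat.{w}) {Z Z' X : C} (c : Z' ⟶ Z) :
    Extn F Z X →+ Extn F Z' X :=
  ((F.map c.op).app X).hom

/-- The extension `δ ⊕ δ' ∈ 𝔼(Z ⊕ Z', X ⊕ X')`, whose components are `δ`, `0`, `0`, `δ'`. -/
noncomputable def sumExtn [Preadditive C] [HasBinaryBiproducts C]
    (F : Cᵒᵖ ⥤ C ⥤ AddCommGrpCat.{w}) {Z X Z' X' : C}
    (δ : Extn F Z X) (δ' : Extn F Z' X') : Extn F (Z ⊞ Z') (X ⊞ X') :=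
  push F biprod.inl (pull F biprod.fst δ) + push F biprod.inr (pull F biprod.snd δ')

end Bifunctor

/-- An extriangulated structure `(𝔼, 𝔰)` on an additive category `C`, in the sense of
Nakaoka and Palu. The correspondence `𝔰` is encoded by the relation `Realizes δ x y`,
which means `𝔰(δ) = [X --x--> Y --y--> Z]`. -/
structure ExtriangulatedStructure (C : Type u) [Category.{v} C] [Preadditive C]
    [HasZeroObject C] [HasBinaryBiproducts C] where
  /-- the bifunctor `𝔼 : Cᵒᵖ × C ⥤ Ab` -/
  E : Cᵒᵖ ⥤ C ⥤ AddCommGrpCat.{w}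
  /-- (ET1): `𝔼` is additive in each variable -/
  additive_right : ∀ Z : Cᵒᵖ, (E.obj Z).Additive
  additive_left : ∀ X : C, (E.flip.obj X).Additive
  Realizes : ∀ {X Y Z : C}, Extn E Z X → (X ⟶ Y) → (Y ⟶ Z) → Prop
  /-- `𝔰(δ)` is exactly one equivalence class of sequences `X ⟶ Y ⟶ Z` -/
  exists_realizes : ∀ {X Z : C} (δ : Extn E Z X),
    ∃ (Y : C) (x : X ⟶ Y) (y : Y ⟶ Z), Realizes δ x y
  realizes_iff : ∀ {X Y Y' Z : C} {δ : Extn E Z X} {x : X ⟶ Y} {y : Y ⟶ Z}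
    (x' : X ⟶ Y') (y' : Y' ⟶ Z), Realizes δ x y →
    (Realizes δ x' y' ↔ ∃ h : Y ≅ Y', x ≫ h.hom = x' ∧ h.hom ≫ y' = y)
  /-- (ET2): `𝔰` is a realization -/
  exists_middle : ∀ {X Y Z X' Y' Z' : C} {δ : Extn E Z X} {δ' : Extn E Z' X'}
    {x : X ⟶ Y} {y : Y ⟶ Z} {x' : X' ⟶ Y'} {y' : Y' ⟶ Z'},
    Realizes δ x y → Realizes δ' x' y' →
    ∀ (a : X ⟶ X') (c : Z ⟶ Z'), push E a δ = pull E c δ' →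
    ∃ b : Y ⟶ Y', x ≫ b = a ≫ x' ∧ y ≫ c = b ≫ y'
  /-- (ET2): `𝔰` is additive -/
  realizes_zero : ∀ X Z : C,
    Realizes (0 : Extn E Z X) (biprod.inl : X ⟶ X ⊞ Z) (biprod.snd : X ⊞ Z ⟶ Z)
  realizes_sum : ∀ {X Y Z X' Y' Z' : C} {δ : Extn E Z X} {δ' : Extn E Z' X'}
    {x : X ⟶ Y} {y : Y ⟶ Z} {x' : X' ⟶ Y'} {y' : Y' ⟶ Z'},
    Realizes δ x y → Realizes δ' x' y' →
    Realizes (sumExtn E δ δ') (biprod.map x x') (biprod.map y y')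
  /-- (ET3) -/
  et3 : ∀ {X Y Z X' Y' Z' : C} {δ : Extn E Z X} {δ' : Extn E Z' X'}
    {x : X ⟶ Y} {y : Y ⟶ Z} {x' : X' ⟶ Y'} {y' : Y' ⟶ Z'},
    Realizes δ x y → Realizes δ' x' y' →
    ∀ (a : X ⟶ X') (b : Y ⟶ Y'), x ≫ b = a ≫ x' →
    ∃ c : Z ⟶ Z', y ≫ c = b ≫ y' ∧ push E a δ = pull E c δ'
  /-- (ET3)ᵒᵖ -/
  et3_op : ∀ {X Y Z X' Y' Z' : C} {δ : Extn E Z X} {δ' : Extn E Z' X'}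
    {x : X ⟶ Y} {y : Y ⟶ Z} {x' : X' ⟶ Y'} {y' : Y' ⟶ Z'},
    Realizes δ x y → Realizes δ' x' y' →
    ∀ (b : Y ⟶ Y') (c : Z ⟶ Z'), y ≫ c = b ≫ y' →
    ∃ a : X ⟶ X', x ≫ b = a ≫ x' ∧ push E a δ = pull E c δ'
  /-- (ET4) -/
  et4 : ∀ {X₁ X₂ X₃ D G : C} {δ : Extn E D X₁} {δ' : Extn E G X₂}
    {f : X₁ ⟶ X₂} {f' : X₂ ⟶ D} {g : X₂ ⟶ X₃} {g' : X₃ ⟶ G},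
    Realizes δ f f' → Realizes δ' g g' →
    ∃ (K : C) (h' : X₃ ⟶ K) (d : D ⟶ K) (e : K ⟶ G) (δ'' : Extn E K X₁),
      Realizes δ'' (f ≫ g) h' ∧ g ≫ h' = f' ≫ d ∧ h' ≫ e = g' ∧
      Realizes (push E f' δ') d e ∧ pull E d δ'' = δ ∧ push E f δ'' = pull E e δ'
  /-- (ET4)ᵒᵖ -/
  et4_op : ∀ {X₁ X₂ X₃ D G : C} {δ : Extn E X₂ D} {δ' : Extn E X₃ G}
    {f' : D ⟶ X₁} {f : X₁ ⟶ X₂} {g' : G ⟶ X₂} {g : X₂ ⟶ X₃},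
    Realizes δ f' f → Realizes δ' g' g →
    ∃ (K : C) (h' : K ⟶ X₁) (d : D ⟶ K) (e : K ⟶ G) (δ'' : Extn E X₃ K),
      Realizes δ'' h' (f ≫ g) ∧ h' ≫ f = e ≫ g' ∧ d ≫ h' = f' ∧
      Realizes (pull E g' δ) d e ∧ push E e δ'' = δ' ∧ push E d δ = pull E g δ''

section Length

variable {C : Type u} [Category.{v} C] [Preadditive C] [HasZeroObject C] [HasBinaryBiproducts C]
  (𝓔 : ExtriangulatedStructure.{w} C) (Θ : C → ℕ)

/-- `Θ` is a length function: a map from isomorphism classes of objects to `ℕ`, vanishing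
exactly on zero objects, subadditive on `𝔼`-triangles and additive on those with `δ = 0`. -/
structure IsLengthFunction : Prop where
  iso_invariant : ∀ {X Y : C}, (X ≅ Y) → Θ X = Θ Y
  eq_zero_iff : ∀ X : C, Θ X = 0 ↔ IsZero X
  le_add : ∀ {X L M : C} {δ : Extn 𝓔.E M X} {x : X ⟶ L} {y : L ⟶ M},
    𝓔.Realizes δ x y → Θ L ≤ Θ X + Θ M
  eq_add : ∀ {X L M : C} {x : X ⟶ L} {y : L ⟶ M},
    𝓔.Realizes (0 : Extn 𝓔.E M X) x y → Θ L = Θ X + Θ M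

/-- `X --x--> L --y--> M` is (with some `δ`) a `Θ`-stable `𝔼`-triangle. -/
def IsStable {X L M : C} (x : X ⟶ L) (y : L ⟶ M) : Prop :=
  (∃ δ : Extn 𝓔.E M X, 𝓔.Realizes δ x y) ∧ Θ L = Θ X + Θ M

/-- `Θ`-inflations. -/
def IsInflation {X L : C} (x : X ⟶ L) : Prop :=
  ∃ (M : C) (y : L ⟶ M), IsStable 𝓔 Θ x y

/-- `Θ`-deflations. -/
def IsDeflation {L M : C} (y : L ⟶ M) : Prop :=
  ∃ (X : C) (x : X ⟶ L), IsStable 𝓔 Θ x y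

/-- `Θ`-admissible morphisms. -/
def IsAdmissible {M N : C} (f : M ⟶ N) : Prop :=
  ∃ (X : C) (i : M ⟶ X) (j : X ⟶ N), IsDeflation 𝓔 Θ i ∧ IsInflation 𝓔 Θ j ∧ i ≫ j = f

/-- `((C, 𝔼, 𝔰), Θ)` is an extriangulated length category. -/
structure IsLengthCategory : Prop where
  isLengthFunction : IsLengthFunction 𝓔 Θ
  isAdmissible : ∀ {M N : C} (f : M ⟶ N), IsAdmissible 𝓔 Θ f

/-- `Fac_Θ(S)`. -/
def fac (S : ObjectProperty C) : ObjectProperty C :=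
  fun M => ∃ (X : C) (y : X ⟶ M), S X ∧ IsDeflation 𝓔 Θ y

/-- `Sub_Θ(S)`. -/
def sub (S : ObjectProperty C) : ObjectProperty C :=
  fun M => ∃ (X : C) (x : M ⟶ X), S X ∧ IsInflation 𝓔 Θ x

/-- `S ∗_Θ T`. -/
def star (S T : ObjectProperty C) : ObjectProperty C :=
  fun M => ∃ (X Y : C) (x : X ⟶ M) (y : M ⟶ Y), S X ∧ T Y ∧ IsStable 𝓔 Θ x y

/-- `Filt_Θ(S)`: the objects `M` with a finite chain `0 = M₀ ↣ M₁ ↣ ⋯ ↣ Mₙ = M` of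
`Θ`-inflations whose cones lie in `S`. -/
inductive filt (S : ObjectProperty C) : ObjectProperty C
  | zero {M : C} (hM : IsZero M) : filt S M
  | step {M N Z : C} (f : M ⟶ N) (g : N ⟶ Z) (hM : filt S M)
      (hfg : IsStable 𝓔 Θ f g) (hZ : S Z) : filt S N

/-- Torsion classes in `(C, Θ)`: (non-empty, full, isomorphism-closed) subcategories `T` with
`Fac_Θ(T) ⊆ T` and `T ∗_Θ T ⊆ T`. -/
structure TorsionClass where
  obj : ObjectProperty C
  nonempty : ∃ X : C, obj X
  isClosedUnderIso : obj.IsClosedUnderIsomorphisms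
  fac_le : fac 𝓔 Θ obj ≤ obj
  star_le : star 𝓔 Θ obj obj ≤ obj

/-- Torsion-free classes in `(C, Θ)`: (non-empty, full, isomorphism-closed) subcategories `F`
with `Sub_Θ(F) ⊆ F` and `F ∗_Θ F ⊆ F`. -/
structure TorsionFreeClass where
  obj : ObjectProperty C
  nonempty : ∃ X : C, obj X
  isClosedUnderIso : obj.IsClosedUnderIsomorphisms
  sub_le : sub 𝓔 Θ obj ≤ obj
  star_le : star 𝓔 Θ obj obj ≤ obj

end Length

/-- Complete semidistributivity of a complete lattice. -/
def IsCompletelySemidistributive (P : Type*) [CompleteLattice P] : Prop :=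
  ∀ (x : P) (L : Set P),
    ((∀ y ∈ L, ∀ z ∈ L, x ⊓ y = x ⊓ z) → ∀ y ∈ L, x ⊓ sSup L = x ⊓ y) ∧
    ((∀ y ∈ L, ∀ z ∈ L, x ⊔ y = x ⊔ z) → ∀ y ∈ L, x ⊔ sInf L = x ⊔ y)

/-- A complete lattice is algebraic if every element is a join of compact elements, where `c` is
compact if `c ≤ ⋁ L` implies `c ≤ ⋁ S` for some finite `S ⊆ L`. -/
def IsAlgebraicLattice (P : Type*) [CompleteLattice P] : Prop :=
  ∀ x : P, ∃ K : Set P, x = sSup K ∧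
    ∀ c ∈ K, ∀ L : Set P, c ≤ sSup L → ∃ S : Set P, S ⊆ L ∧ S.Finite ∧ c ≤ sSup S

end Extri

/-! The argument for torsion classes in an abelian length category carries over once one substitute
is found for monomorphisms and epimorphisms, since a `Θ`-inflation need not be monic. The substitute
is that a zero `Θ`-inflation has zero source and a zero `Θ`-deflation has zero target
(`isZero_of_isInflation_zero`, `isZero_of_isDeflation_zero`). If `0 : X ⟶ L` is a `Θ`-inflation with
cone `M`, then `L` is a retract of `M`. Idempotents split, so lengths do not grow under retracts,
and `Θ L = Θ X + Θ M` forces `Θ X = 0`.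

Factoring a nonzero morphism through its image and inducting on length then gives, for `S` closed
under quotients, a canonical sequence of every object relative to `filt S` and `S^⊥`, hence `filt S
= ^⊥(S^⊥)`; the dual holds for `S` closed under subobjects. Applied to unions of classes, this
yields the formulas for joins and the duality `T ↦ T^⊥`.

Semidistributivity is a further induction on length that splits off a nonzero image. Algebraicity
holds because a filtration has finitely many factors. -/

namespace Extri

section Basic

variable {C : Type u} [Category.{v} C] [Preadditive C] [HasZeroObject C] [HasBinaryBiproducts C]
  {𝓔 : ExtriangulatedStructure.{w} C} {Θ : C → ℕ}

/-! ### Elementary properties of `𝔼`-triangles -/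

namespace ExtriangulatedStructure

lemma realizes_iso_zero {X Y Z : C} (e : X ≅ Y) (hZ : IsZero Z) :
    𝓔.Realizes (0 : Extn 𝓔.E Z X) e.hom (0 : Y ⟶ Z) := by
  refine (𝓔.realizes_iff _ _ (𝓔.realizes_zero X Z)).2
    ⟨{ hom := biprod.fst, inv := biprod.inl, hom_inv_id := ?_ } ≪≫ e, by simp, hZ.eq_of_tgt _ _⟩
  have h := biprod.total (X := X) (Y := Z)
  rwa [hZ.eq_of_tgt (biprod.snd : X ⊞ Z ⟶ Z) 0, zero_comp, add_zero] at h

lemma realizes_zero_iso {X Y Z : C} (hX : IsZero X) (e : Y ≅ Z) :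
    𝓔.Realizes (0 : Extn 𝓔.E Z X) (0 : X ⟶ Y) e.hom := by
  refine (𝓔.realizes_iff _ _ (𝓔.realizes_zero X Z)).2
    ⟨{ hom := biprod.snd, inv := biprod.inr, hom_inv_id := ?_ } ≪≫ e.symm,
      hX.eq_of_src _ _, by simp⟩
  have h := biprod.total (X := X) (Y := Z)
  rwa [hX.eq_of_tgt (biprod.fst : X ⊞ Z ⟶ X) 0, zero_comp, zero_add] at h

variable {X L M : C} {δ : Extn 𝓔.E M X} {x : X ⟶ L} {y : L ⟶ M}

/-- Weak kernel property: (ET3)ᵒᵖ applied to a map from the trivial triangle `W = W ⟶ 0`. The lift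
is not unique. -/
lemma exists_lift (h : 𝓔.Realizes δ x y) {W : C} (f : W ⟶ L) (hf : f ≫ y = 0) :
    ∃ g : W ⟶ X, g ≫ x = f := by
  obtain ⟨a, ha, -⟩ := 𝓔.et3_op (realizes_iso_zero (Iso.refl W) (isZero_zero C)) h f 0 (by simp [hf])
  exact ⟨a, by simpa using ha.symm⟩

lemma exists_desc (h : 𝓔.Realizes δ x y) {W : C} (f : L ⟶ W) (hf : x ≫ f = 0) :
    ∃ g : M ⟶ W, y ≫ g = f := by
  obtain ⟨c, hc, -⟩ := 𝓔.et3 h (realizes_zero_iso (isZero_zero C) (Iso.refl W)) 0 f (by simp [hf])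
  exact ⟨c, by simpa using hc⟩

/-- Additivity of `𝔼` kills `𝔼(0, X)`, so `δ = 0`, and realizations of one extension are unique up
to isomorphism. -/
lemma isIso_left_of_isZero (h : 𝓔.Realizes δ x y) (hM : IsZero M) : IsIso x := by
  have hδ : δ = 0 := by
    have := 𝓔.additive_left X
    have h₁ : pull 𝓔.E (𝟙 M) δ = δ := by simp [pull]
    have h₂ : (𝓔.E.flip.obj X).map (0 : M ⟶ M).op = 0 := (𝓔.E.flip.obj X).map_zero _ _
    have h₃ : pull 𝓔.E (0 : M ⟶ M) δ = 0 := ConcreteCategory.congr_hom h₂ δ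
    rw [← h₁, hM.eq_of_src (𝟙 M) 0, h₃]
  subst hδ
  obtain ⟨e, he, -⟩ := (𝓔.realizes_iff _ _ (realizes_iso_zero (Iso.refl X) hM)).1 h
  rw [← he]
  infer_instance

lemma isIso_right_of_isZero (h : 𝓔.Realizes δ x y) (hX : IsZero X) : IsIso y := by
  have hδ : δ = 0 := by
    have := 𝓔.additive_right (op M)
    have h₁ : push 𝓔.E (𝟙 X) δ = δ := by simp [push]
    have h₂ : (𝓔.E.obj (op M)).map (0 : X ⟶ X) = 0 := (𝓔.E.obj (op M)).map_zero _ _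
    have h₃ : push 𝓔.E (0 : X ⟶ X) δ = 0 := ConcreteCategory.congr_hom h₂ δ
    rw [← h₁, hX.eq_of_src (𝟙 X) 0, h₃]
  subst hδ
  obtain ⟨e, -, he⟩ := (𝓔.realizes_iff _ _ (realizes_zero_iso hX (Iso.refl M))).1 h
  rw [Iso.refl_hom, ← Iso.eq_inv_comp, Category.comp_id] at he
  rw [he]
  infer_instance

end ExtriangulatedStructure

/-! ### `Θ`-stable `𝔼`-triangles -/

lemma IsStable.exists_lift {X L M : C} {x : X ⟶ L} {y : L ⟶ M} (h : IsStable 𝓔 Θ x y)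
    {W : C} (f : W ⟶ L) (hf : f ≫ y = 0) : ∃ g : W ⟶ X, g ≫ x = f :=
  ExtriangulatedStructure.exists_lift h.1.choose_spec f hf

lemma IsStable.exists_desc {X L M : C} {x : X ⟶ L} {y : L ⟶ M} (h : IsStable 𝓔 Θ x y)
    {W : C} (f : L ⟶ W) (hf : x ≫ f = 0) : ∃ g : M ⟶ W, y ≫ g = f :=
  ExtriangulatedStructure.exists_desc h.1.choose_spec f hf

lemma IsStable.isIso_left {X L M : C} {x : X ⟶ L} {y : L ⟶ M} (h : IsStable 𝓔 Θ x y)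
    (hM : IsZero M) : IsIso x :=
  ExtriangulatedStructure.isIso_left_of_isZero h.1.choose_spec hM

lemma IsStable.isIso_right {X L M : C} {x : X ⟶ L} {y : L ⟶ M} (h : IsStable 𝓔 Θ x y)
    (hX : IsZero X) : IsIso y :=
  ExtriangulatedStructure.isIso_right_of_isZero h.1.choose_spec hX

end Basic

open ExtriangulatedStructure ZeroObject

section Length

variable {C : Type u} [Category.{v} C] [Preadditive C] [HasZeroObject C] [HasBinaryBiproducts C]
  {𝓔 : ExtriangulatedStructure.{w} C} {Θ : C → ℕ}

/-! ### Stable triangles under composition. -/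

namespace IsLengthFunction

lemma isStable_iso_zero (hΘ : IsLengthFunction 𝓔 Θ) {X Y Z : C} (e : X ≅ Y) (hZ : IsZero Z) :
    IsStable 𝓔 Θ e.hom (0 : Y ⟶ Z) :=
  ⟨⟨0, realizes_iso_zero e hZ⟩, by rw [hΘ.iso_invariant e, (hΘ.eq_zero_iff Z).2 hZ, add_zero]⟩

lemma isStable_zero_iso (hΘ : IsLengthFunction 𝓔 Θ) {X Y Z : C} (hX : IsZero X) (e : Y ≅ Z) :
    IsStable 𝓔 Θ (0 : X ⟶ Y) e.hom :=
  ⟨⟨0, realizes_zero_iso hX e⟩, by rw [hΘ.iso_invariant e, (hΘ.eq_zero_iff X).2 hX, zero_add]⟩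

lemma isStable_middle_iso (hΘ : IsLengthFunction 𝓔 Θ) {X L L' M : C} {x : X ⟶ L} {y : L ⟶ M}
    (h : IsStable 𝓔 Θ x y) (e : L ≅ L') : IsStable 𝓔 Θ (x ≫ e.hom) (e.inv ≫ y) := by
  obtain ⟨⟨δ, hδ⟩, hL⟩ := h
  exact ⟨⟨δ, (𝓔.realizes_iff _ _ hδ).2 ⟨e, rfl, by simp⟩⟩, by rw [← hΘ.iso_invariant e, hL]⟩

/-- (ET4) supplies both triangles. Subadditivity gives `Θ X₃ ≤ Θ X₁ + Θ K ≤ Θ X₁ + Θ D + Θ G`;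
stability of the given triangles makes the outer terms equal, so both new triangles are stable. -/
lemma isStable_comp_inflation (hΘ : IsLengthFunction 𝓔 Θ) {X₁ X₂ X₃ D G : C} {f : X₁ ⟶ X₂}
    {f' : X₂ ⟶ D} {g : X₂ ⟶ X₃} {g' : X₃ ⟶ G} (hf : IsStable 𝓔 Θ f f')
    (hg : IsStable 𝓔 Θ g g') :
    ∃ (K : C) (h' : X₃ ⟶ K) (d : D ⟶ K) (e : K ⟶ G),
      IsStable 𝓔 Θ (f ≫ g) h' ∧ IsStable 𝓔 Θ d e := by
  obtain ⟨⟨δ, hδ⟩, h₁⟩ := hf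
  obtain ⟨⟨δ', hδ'⟩, h₂⟩ := hg
  obtain ⟨K, h', d, e, δ'', r, -, -, s, -, -⟩ := 𝓔.et4 hδ hδ'
  have := hΘ.le_add r
  have := hΘ.le_add s
  exact ⟨K, h', d, e, ⟨⟨_, r⟩, by omega⟩, ⟨⟨_, s⟩, by omega⟩⟩

lemma isStable_comp_deflation (hΘ : IsLengthFunction 𝓔 Θ) {X₁ X₂ X₃ D G : C} {f' : D ⟶ X₁}
    {f : X₁ ⟶ X₂} {g' : G ⟶ X₂} {g : X₂ ⟶ X₃} (hf : IsStable 𝓔 Θ f' f)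
    (hg : IsStable 𝓔 Θ g' g) :
    ∃ (K : C) (h' : K ⟶ X₁) (d : D ⟶ K) (e : K ⟶ G),
      IsStable 𝓔 Θ h' (f ≫ g) ∧ IsStable 𝓔 Θ d e := by
  obtain ⟨⟨δ, hδ⟩, h₁⟩ := hf
  obtain ⟨⟨δ', hδ'⟩, h₂⟩ := hg
  obtain ⟨K, h', d, e, δ'', r, -, -, s, -, -⟩ := 𝓔.et4_op hδ hδ'
  have := hΘ.le_add r
  have := hΘ.le_add s
  exact ⟨K, h', d, e, ⟨⟨_, r⟩, by omega⟩, ⟨⟨_, s⟩, by omega⟩⟩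

lemma isInflation_comp (hΘ : IsLengthFunction 𝓔 Θ) {X Y Z : C} {f : X ⟶ Y} {g : Y ⟶ Z}
    (hf : IsInflation 𝓔 Θ f) (hg : IsInflation 𝓔 Θ g) : IsInflation 𝓔 Θ (f ≫ g) := by
  obtain ⟨D, f', hf⟩ := hf
  obtain ⟨G, g', hg⟩ := hg
  obtain ⟨K, h', -, -, h, -⟩ := hΘ.isStable_comp_inflation hf hg
  exact ⟨K, h', h⟩

lemma isDeflation_comp (hΘ : IsLengthFunction 𝓔 Θ) {X Y Z : C} {f : X ⟶ Y} {g : Y ⟶ Z}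
    (hf : IsDeflation 𝓔 Θ f) (hg : IsDeflation 𝓔 Θ g) : IsDeflation 𝓔 Θ (f ≫ g) := by
  obtain ⟨D, f', hf⟩ := hf
  obtain ⟨G, g', hg⟩ := hg
  obtain ⟨K, h', -, -, h, -⟩ := hΘ.isStable_comp_deflation hf hg
  exact ⟨K, h', h⟩

end IsLengthFunction

/-! ### Retracts and vanishing of zero inflations and deflations. -/

namespace IsLengthCategory

/-- Idempotents split, by induction on the length: an idempotent which is not an isomorphism
factors through an object of smaller length. -/
lemma isIdempotentComplete (hΘ : IsLengthCategory 𝓔 Θ) : IsIdempotentComplete C where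
  idempotents_split X := by
    induction hn : Θ X using Nat.strong_induction_on generalizing X with
    | h n ih =>
      subst hn
      intro p hp
      obtain ⟨P, i, j, ⟨W, k, hi⟩, ⟨V, c, hj⟩, hij⟩ := hΘ.isAdmissible p
      by_cases hP : Θ P < Θ X
      -- Since `i` need not be epic nor `j` monic, `j ≫ i` itself may fail to be idempotent, but its
      -- square is.
      · have hq : (j ≫ i ≫ j ≫ i) ≫ (j ≫ i ≫ j ≫ i) = j ≫ i ≫ j ≫ i := by
          have h : p ≫ p ≫ p = p := by rw [hp, hp]
          calc _ = j ≫ (i ≫ j) ≫ (i ≫ j) ≫ (i ≫ j) ≫ i := by simp only [Category.assoc]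
            _ = j ≫ (p ≫ p ≫ p) ≫ i := by rw [hij]; simp only [Category.assoc]
            _ = _ := by rw [h, ← hij]; simp only [Category.assoc]
        obtain ⟨Y, a, b, hab, hba⟩ := ih _ hP P rfl _ hq
        refine ⟨Y, a ≫ j, i ≫ j ≫ i ≫ b, ?_, ?_⟩
        · calc _ = a ≫ (j ≫ i ≫ j ≫ i) ≫ b := by simp only [Category.assoc]
            _ = _ := by rw [← hba]; simp [hab]
        · calc _ = (i ≫ j) ≫ i ≫ (b ≫ a) ≫ j := by simp only [Category.assoc]
            _ = (i ≫ j) ≫ (i ≫ j) ≫ (i ≫ j) ≫ (i ≫ j) := by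
              rw [hba]; simp only [Category.assoc]
            _ = p := by rw [hij, hp, hp, hp]
      -- Now `Θ P = Θ X`, so kernel and cone vanish; `i` and `j` are isomorphisms, and an invertible
      -- idempotent is the identity.
      · have h₁ := hi.2
        have h₂ := hj.2
        have := hi.isIso_right ((hΘ.isLengthFunction.eq_zero_iff W).1 (by omega))
        have := hj.isIso_left ((hΘ.isLengthFunction.eq_zero_iff V).1 (by omega))
        have : IsIso p := hij ▸ inferInstance
        exact ⟨X, 𝟙 X, 𝟙 X, by simp, by rw [← cancel_epi p, hp]; simp⟩

lemma le_of_retract (hΘ : IsLengthCategory 𝓔 Θ) {X Y : C} (i : X ⟶ Y) (r : Y ⟶ X)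
    (h : i ≫ r = 𝟙 X) : Θ X ≤ Θ Y := by
  have := hΘ.isIdempotentComplete
  have hir : i ≫ r ≫ i = i := by rw [← Category.assoc, h, Category.id_comp]
  have hri : r ≫ i ≫ r = r := by rw [h, Category.comp_id]
  -- Splitting the complementary idempotent exhibits `Y` as `X ⊞ Z`, on which `Θ` is additive.
  obtain ⟨Z, a, b, hab, hba⟩ := IsIdempotentComplete.idempotents_split Y (𝟙 Y - r ≫ i)
    (by simp [hir])
  have har : a ≫ r = 0 := by
    have : a ≫ (b ≫ a) ≫ r = 0 := by rw [hba]; simp [h]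
    rwa [Category.assoc, ← Category.assoc, hab, Category.id_comp] at this
  have hib : i ≫ b = 0 := by
    have : i ≫ (b ≫ a) ≫ b = 0 := by rw [hba]; simp [reassoc_of% h]
    rwa [Category.assoc, hab, Category.comp_id] at this
  let e : X ⊞ Z ≅ Y :=
    { hom := biprod.desc i a
      inv := biprod.lift r b
      hom_inv_id := by ext <;> simp [h, har, hib, hab]
      inv_hom_id := by simp [hba] }
  rw [← hΘ.isLengthFunction.iso_invariant e,
    hΘ.isLengthFunction.eq_add (𝓔.realizes_zero X Z)]
  omega

/-- As the inflation is zero, `𝟙 L` factors through the cone, so `Θ L ≤ Θ M`. This plays the role of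
cancelling a monomorphism. -/
lemma isZero_of_isInflation_zero (hΘ : IsLengthCategory 𝓔 Θ) {X L : C}
    (h : IsInflation 𝓔 Θ (0 : X ⟶ L)) : IsZero X := by
  obtain ⟨M, y, h⟩ := h
  obtain ⟨r, hr⟩ := h.exists_desc (𝟙 L) (by simp)
  have h₁ := hΘ.le_of_retract y r hr
  have h₂ := h.2
  exact (hΘ.isLengthFunction.eq_zero_iff X).1 (by omega)

lemma isZero_of_isDeflation_zero (hΘ : IsLengthCategory 𝓔 Θ) {L M : C}
    (h : IsDeflation 𝓔 Θ (0 : L ⟶ M)) : IsZero M := by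
  obtain ⟨X, x, h⟩ := h
  obtain ⟨s, hs⟩ := h.exists_lift (𝟙 L) (by simp)
  have h₁ := hΘ.le_of_retract s x hs
  have h₂ := h.2
  exact (hΘ.isLengthFunction.eq_zero_iff M).1 (by omega)

end IsLengthCategory

/-! ### Filtrations -/

lemma filt_of_iso (hΘ : IsLengthFunction 𝓔 Θ) {S : ObjectProperty C} {M N : C}
    (hM : filt 𝓔 Θ S M) (e : M ≅ N) : filt 𝓔 Θ S N := by
  cases hM with
  | zero hM => exact .zero (hM.of_iso e.symm)
  | step f g hM hfg hZ => exact .step _ _ hM (hΘ.isStable_middle_iso hfg e) hZ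

lemma le_filt (hΘ : IsLengthFunction 𝓔 Θ) (S : ObjectProperty C) : S ≤ filt 𝓔 Θ S :=
  fun M hM => .step _ _ (.zero (isZero_zero C))
    (hΘ.isStable_zero_iso (isZero_zero C) (Iso.refl M)) hM

lemma filt_mono {S T : ObjectProperty C} (h : S ≤ T) : filt 𝓔 Θ S ≤ filt 𝓔 Θ T := by
  intro M hM
  induction hM with
  | zero hM => exact .zero hM
  | step f g _ hfg hZ ih => exact .step f g ih hfg (h _ hZ)

/-- Induction on the filtration of the right-hand term: (ET4)ᵒᵖ removes its top factor from `M`,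
leaving an extension with a shorter right-hand term. -/
lemma filt_star_le (hΘ : IsLengthFunction 𝓔 Θ) (S : ObjectProperty C) :
    star 𝓔 Θ (filt 𝓔 Θ S) (filt 𝓔 Θ S) ≤ filt 𝓔 Θ S := by
  rintro M ⟨X, Y, x, y, hX, hY, h⟩
  induction hY generalizing M with
  | zero hY =>
    have := h.isIso_left hY
    exact filt_of_iso hΘ hX (asIso x)
  | step f g _ hfg hZ ih =>
    obtain ⟨K, h', d, e, h₁, h₂⟩ := hΘ.isStable_comp_deflation h hfg
    exact .step _ _ (ih K d e h₂) h₁ hZ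

/-- The filtration closure lies in every class that contains the zero objects and is closed
under extensions. -/
lemma filt_le {S T : ObjectProperty C} (hzero : ∀ M, IsZero M → T M)
    (hstar : star 𝓔 Θ T T ≤ T) (h : S ≤ T) : filt 𝓔 Θ S ≤ T := by
  intro M hM
  induction hM with
  | zero hM => exact hzero _ hM
  | step f g _ hfg hZ ih => exact hstar _ ⟨_, _, f, g, ih, h _ hZ, hfg⟩

/-! ### Orthogonal classes and canonical sequences -/

lemma rightOrthogonal_star_le (S : ObjectProperty C) :
    star 𝓔 Θ S.rightOrthogonal S.rightOrthogonal ≤ S.rightOrthogonal := by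
  rintro M ⟨X, Y, x, y, hX, hY, h⟩ T f hT
  obtain ⟨g, rfl⟩ := h.exists_lift f (hY _ hT)
  rw [hX g hT, zero_comp]

lemma leftOrthogonal_star_le (S : ObjectProperty C) :
    star 𝓔 Θ S.leftOrthogonal S.leftOrthogonal ≤ S.leftOrthogonal := by
  rintro M ⟨X, Y, x, y, hX, hY, h⟩ T f hT
  obtain ⟨g, rfl⟩ := h.exists_desc f (hX _ hT)
  rw [hY g hT, comp_zero]

lemma filt_le_leftOrthogonal_rightOrthogonal (S : ObjectProperty C) :
    filt 𝓔 Θ S ≤ S.rightOrthogonal.leftOrthogonal :=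
  filt_le (fun _ hM _ _ _ => hM.eq_of_src _ _) (leftOrthogonal_star_le _)
    fun _ hM _ f hY => hY f hM

lemma filt_le_rightOrthogonal_leftOrthogonal (S : ObjectProperty C) :
    filt 𝓔 Θ S ≤ S.leftOrthogonal.rightOrthogonal :=
  filt_le (fun _ hM _ _ _ => hM.eq_of_tgt _ _) (rightOrthogonal_star_le _)
    fun _ hM _ f hY => hY f hM

namespace IsLengthCategory

/-- The object is the image of a nonzero morphism out of `S`. It drives the inductions on length,
because its cone is strictly shorter than `M`. -/
lemma exists_isInflation_of_not_rightOrthogonal (hΘ : IsLengthCategory 𝓔 Θ)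
    {S : ObjectProperty C} (hS : fac 𝓔 Θ S ≤ S) {M : C} (hM : ¬ S.rightOrthogonal M) :
    ∃ (I : C) (j : I ⟶ M), S I ∧ ¬ IsZero I ∧ IsInflation 𝓔 Θ j := by
  rw [ObjectProperty.rightOrthogonal_iff] at hM
  push Not at hM
  obtain ⟨T, f, hT, hf⟩ := hM
  obtain ⟨I, i, j, hi, hj, rfl⟩ := hΘ.isAdmissible f
  exact ⟨I, j, hS _ ⟨T, i, hT, hi⟩, fun h => hf (by rw [h.eq_of_src j 0, comp_zero]), hj⟩

lemma exists_isDeflation_of_not_leftOrthogonal (hΘ : IsLengthCategory 𝓔 Θ)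
    {S : ObjectProperty C} (hS : sub 𝓔 Θ S ≤ S) {M : C} (hM : ¬ S.leftOrthogonal M) :
    ∃ (I : C) (i : M ⟶ I), S I ∧ ¬ IsZero I ∧ IsDeflation 𝓔 Θ i := by
  rw [ObjectProperty.leftOrthogonal_iff] at hM
  push Not at hM
  obtain ⟨T, f, hT, hf⟩ := hM
  obtain ⟨I, i, j, hi, hj, rfl⟩ := hΘ.isAdmissible f
  exact ⟨I, i, hS _ ⟨T, j, hT, hj⟩, fun h => hf (by rw [h.eq_of_src j 0, comp_zero]), hi⟩

/-- A nonzero image `I` in `M` would compose to a `Θ`-inflation `I ⟶ X` from an object of `S` to one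
of `S^⊥`. That composite is zero, so `I` would be zero. -/
lemma sub_rightOrthogonal_le (hΘ : IsLengthCategory 𝓔 Θ) {S : ObjectProperty C}
    (hS : fac 𝓔 Θ S ≤ S) : sub 𝓔 Θ S.rightOrthogonal ≤ S.rightOrthogonal := by
  rintro M ⟨X, x, hX, hx⟩
  by_contra hM
  obtain ⟨I, j, hI, hI', hj⟩ := hΘ.exists_isInflation_of_not_rightOrthogonal hS hM
  have h := hΘ.isLengthFunction.isInflation_comp hj hx
  rw [hX (j ≫ x) hI] at h
  exact hI' (hΘ.isZero_of_isInflation_zero h)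

lemma fac_leftOrthogonal_le (hΘ : IsLengthCategory 𝓔 Θ) {S : ObjectProperty C}
    (hS : sub 𝓔 Θ S ≤ S) : fac 𝓔 Θ S.leftOrthogonal ≤ S.leftOrthogonal := by
  rintro M ⟨X, x, hX, hx⟩
  by_contra hM
  obtain ⟨I, i, hI, hI', hi⟩ := hΘ.exists_isDeflation_of_not_leftOrthogonal hS hM
  have h := hΘ.isLengthFunction.isDeflation_comp hx hi
  rw [hX (x ≫ i) hI] at h
  exact hI' (hΘ.isZero_of_isDeflation_zero h)

/-- If `S` is closed under `Θ`-quotients, every object is an extension of an object of `S^⊥`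
by an object filtered by `S`. -/
lemma exists_isStable_filt_rightOrthogonal (hΘ : IsLengthCategory 𝓔 Θ) {S : ObjectProperty C}
    (hS : fac 𝓔 Θ S ≤ S) (M : C) : star 𝓔 Θ (filt 𝓔 Θ S) S.rightOrthogonal M := by
  induction hn : Θ M using Nat.strong_induction_on generalizing M with
  | h n ih =>
    subst hn
    by_cases hM : S.rightOrthogonal M
    · exact ⟨0, M, 0, 𝟙 M, .zero (isZero_zero C), hM,
        hΘ.isLengthFunction.isStable_zero_iso (isZero_zero C) (Iso.refl M)⟩
    obtain ⟨I, j, hI, hI', M', c, hj⟩ := hΘ.exists_isInflation_of_not_rightOrthogonal hS hM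
    have h₁ := hj.2
    have h₂ : Θ I ≠ 0 := fun h => hI' ((hΘ.isLengthFunction.eq_zero_iff I).1 h)
    obtain ⟨T, F, t, f, hT, hF, htf⟩ := ih _ (by omega) M' rfl
    obtain ⟨K, h', d, e, h₃, h₄⟩ := hΘ.isLengthFunction.isStable_comp_deflation hj htf
    -- The new factor `I` enters at the bottom of the filtration, so closure of `filt` under
    -- extensions is needed.
    exact ⟨K, F, h', c ≫ f, filt_star_le hΘ.isLengthFunction S _
      ⟨I, T, d, e, le_filt hΘ.isLengthFunction S _ hI, hT, h₄⟩, hF, h₃⟩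

/-- If `S` is closed under `Θ`-subobjects, every object is an extension of an object filtered
by `S` by an object of `^⊥S`. -/
lemma exists_isStable_leftOrthogonal_filt (hΘ : IsLengthCategory 𝓔 Θ) {S : ObjectProperty C}
    (hS : sub 𝓔 Θ S ≤ S) (M : C) : star 𝓔 Θ S.leftOrthogonal (filt 𝓔 Θ S) M := by
  induction hn : Θ M using Nat.strong_induction_on generalizing M with
  | h n ih =>
    subst hn
    by_cases hM : S.leftOrthogonal M
    · exact ⟨M, 0, 𝟙 M, 0, hM, .zero (isZero_zero C),
        hΘ.isLengthFunction.isStable_iso_zero (Iso.refl M) (isZero_zero C)⟩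
    obtain ⟨I, i, hI, hI', M', k, hi⟩ := hΘ.exists_isDeflation_of_not_leftOrthogonal hS hM
    have h₁ := hi.2
    have h₂ : Θ I ≠ 0 := fun h => hI' ((hΘ.isLengthFunction.eq_zero_iff I).1 h)
    obtain ⟨T, F, t, f, hT, hF, htf⟩ := ih _ (by omega) M' rfl
    obtain ⟨K, h', d, e, h₃, h₄⟩ := hΘ.isLengthFunction.isStable_comp_inflation htf hi
    -- Here `I` is added on top, so a single filtration step suffices.
    exact ⟨T, K, t ≫ k, h', hT, .step d e hF h₄ hI, h₃⟩

/-- For `M` in the double orthogonal, the deflation of the canonical sequence is zero, so its target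
vanishes and `M` is isomorphic to the filtered part. -/
lemma filt_eq_leftOrthogonal_rightOrthogonal (hΘ : IsLengthCategory 𝓔 Θ) {S : ObjectProperty C}
    (hS : fac 𝓔 Θ S ≤ S) : filt 𝓔 Θ S = S.rightOrthogonal.leftOrthogonal := by
  refine le_antisymm (filt_le_leftOrthogonal_rightOrthogonal S) fun M hM => ?_
  obtain ⟨X, Y, x, y, hX, hY, h⟩ := hΘ.exists_isStable_filt_rightOrthogonal hS M
  have hy : IsDeflation 𝓔 Θ (0 : M ⟶ Y) := hM y hY ▸ ⟨X, x, h⟩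
  have := h.isIso_left (hΘ.isZero_of_isDeflation_zero hy)
  exact filt_of_iso hΘ.isLengthFunction hX (asIso x)

lemma filt_eq_rightOrthogonal_leftOrthogonal (hΘ : IsLengthCategory 𝓔 Θ) {S : ObjectProperty C}
    (hS : sub 𝓔 Θ S ≤ S) : filt 𝓔 Θ S = S.leftOrthogonal.rightOrthogonal := by
  refine le_antisymm (filt_le_rightOrthogonal_leftOrthogonal S) fun M hM => ?_
  obtain ⟨X, Y, x, y, hX, hY, h⟩ := hΘ.exists_isStable_leftOrthogonal_filt hS M
  have hx : IsInflation 𝓔 Θ (0 : X ⟶ M) := hM x hX ▸ ⟨Y, y, h⟩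
  have := h.isIso_right (hΘ.isZero_of_isInflation_zero hx)
  exact filt_of_iso hΘ.isLengthFunction hY (asIso y).symm

end IsLengthCategory

end Length

/-! ### Orthogonals of unions. -/

section Orthogonal

variable {C : Type u} [Category.{v} C] [Preadditive C]

lemma rightOrthogonal_biSup {ι : Type*} (L : Set ι) (P : ι → ObjectProperty C) :
    (⨆ i ∈ L, P i).rightOrthogonal = ⨅ i ∈ L, (P i).rightOrthogonal := by
  ext M
  simp only [ObjectProperty.rightOrthogonal_iff, ObjectProperty.prop_iSup_iff, iInf_apply,
    iInf_Prop_eq]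
  exact ⟨fun h i hi X f hX => h f ⟨i, hi, hX⟩, fun h X f ⟨i, hi, hX⟩ => h i hi f hX⟩

lemma leftOrthogonal_biSup {ι : Type*} (L : Set ι) (P : ι → ObjectProperty C) :
    (⨆ i ∈ L, P i).leftOrthogonal = ⨅ i ∈ L, (P i).leftOrthogonal := by
  ext M
  simp only [ObjectProperty.leftOrthogonal_iff, ObjectProperty.prop_iSup_iff, iInf_apply,
    iInf_Prop_eq]
  exact ⟨fun h i hi X f hX => h f ⟨i, hi, hX⟩, fun h X f ⟨i, hi, hX⟩ => h i hi f hX⟩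

lemma isZero_of_rightOrthogonal {S : ObjectProperty C} {M : C} (hM : S M)
    (h : S.rightOrthogonal M) : IsZero M :=
  (IsZero.iff_id_eq_zero M).2 (h (𝟙 M) hM)

end Orthogonal

section Lattice

variable {C : Type u} [Category.{v} C] [Preadditive C] [HasZeroObject C] [HasBinaryBiproducts C]
  {𝓔 : ExtriangulatedStructure.{w} C} {Θ : C → ℕ}

/-- An object with a filtration by a union of classes has one by a finite union. -/
lemma filt_biSup_finite {ι : Type*} {L : Set ι} {P : ι → ObjectProperty C} {M : C}
    (hM : filt 𝓔 Θ (⨆ i ∈ L, P i) M) :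
    ∃ S : Set ι, S ⊆ L ∧ S.Finite ∧ filt 𝓔 Θ (⨆ i ∈ S, P i) M := by
  induction hM with
  | zero hM => exact ⟨∅, Set.empty_subset _, Set.finite_empty, .zero hM⟩
  | step f g _ hfg hZ ih =>
    obtain ⟨S, hSL, hS, hM⟩ := ih
    simp only [ObjectProperty.prop_iSup_iff] at hZ
    obtain ⟨i, hi, hZ⟩ := hZ
    refine ⟨insert i S, Set.insert_subset hi hSL, hS.insert i, .step f g
      (filt_mono (biSup_mono fun _ => Set.mem_insert_of_mem i) _ hM) hfg ?_⟩
    simp only [ObjectProperty.prop_iSup_iff]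
    exact ⟨i, Set.mem_insert i S, hZ⟩

/-! ### The lattice of torsion classes -/

/-- The inclusion order on torsion classes. -/
@[reducible]
def TorsionClass.partialOrder : PartialOrder (TorsionClass 𝓔 Θ) :=
  PartialOrder.lift TorsionClass.obj fun T U h => by cases T; cases U; congr

/-- The inclusion order on torsion-free classes. -/
@[reducible]
def TorsionFreeClass.partialOrder : PartialOrder (TorsionFreeClass 𝓔 Θ) :=
  PartialOrder.lift TorsionFreeClass.obj fun T U h => by cases T; cases U; congr

attribute [local instance] TorsionClass.partialOrder TorsionFreeClass.partialOrder

namespace TorsionClass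

lemma obj_of_isZero (hΘ : IsLengthFunction 𝓔 Θ) (T : TorsionClass 𝓔 Θ) {M : C} (hM : IsZero M) :
    T.obj M := by
  obtain ⟨X, hX⟩ := T.nonempty
  exact T.fac_le _ ⟨X, 0, hX, X, 𝟙 X, hΘ.isStable_iso_zero (Iso.refl X) hM⟩

lemma leftOrthogonal_rightOrthogonal (hΘ : IsLengthCategory 𝓔 Θ) (T : TorsionClass 𝓔 Θ) :
    T.obj.rightOrthogonal.leftOrthogonal = T.obj := by
  rw [← hΘ.filt_eq_leftOrthogonal_rightOrthogonal T.fac_le]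
  exact le_antisymm (filt_le (fun _ => T.obj_of_isZero hΘ.isLengthFunction) T.star_le le_rfl)
    (le_filt hΘ.isLengthFunction _)

/-- The torsion class `^⊥S`, for `S` closed under `Θ`-subobjects. -/
def ofLeftOrthogonal (hΘ : IsLengthCategory 𝓔 Θ) (S : ObjectProperty C)
    (hS : sub 𝓔 Θ S ≤ S) : TorsionClass 𝓔 Θ where
  obj := S.leftOrthogonal
  nonempty := ⟨0, fun _ _ _ => (isZero_zero C).eq_of_src _ _⟩
  isClosedUnderIso := inferInstance
  fac_le := hΘ.fac_leftOrthogonal_le hS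
  star_le := leftOrthogonal_star_le S

/-- The intersection of a set of torsion classes. -/
def inter (hΘ : IsLengthFunction 𝓔 Θ) (L : Set (TorsionClass 𝓔 Θ)) : TorsionClass 𝓔 Θ where
  obj := ⨅ T ∈ L, T.obj
  nonempty := ⟨0, by
    simp only [iInf_apply, iInf_Prop_eq]
    exact fun T _ => T.obj_of_isZero hΘ (isZero_zero C)⟩
  isClosedUnderIso := ⟨fun e h => by
    simp only [iInf_apply, iInf_Prop_eq] at h ⊢
    exact fun T hT => T.isClosedUnderIso.of_iso e (h T hT)⟩
  fac_le := by
    rintro M ⟨X, y, hX, hy⟩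
    simp only [iInf_apply, iInf_Prop_eq] at hX ⊢
    exact fun T hT => T.fac_le _ ⟨X, y, hX T hT, hy⟩
  star_le := by
    rintro M ⟨X, Y, x, y, hX, hY, h⟩
    simp only [iInf_apply, iInf_Prop_eq] at hX hY ⊢
    exact fun T hT => T.star_le _ ⟨X, Y, x, y, hX T hT, hY T hT, h⟩

/-- The complete lattice of torsion classes, ordered by inclusion. -/
@[reducible]
def completeLattice (hΘ : IsLengthFunction 𝓔 Θ) : CompleteLattice (TorsionClass 𝓔 Θ) :=
  letI : InfSet (TorsionClass 𝓔 Θ) := ⟨inter hΘ⟩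
  completeLatticeOfInf _ fun L =>
    ⟨fun _ hT => iInf₂_le (f := fun (U : TorsionClass 𝓔 Θ) (_ : U ∈ L) => U.obj) _ hT,
      fun _ hT => le_iInf₂ (f := fun (U : TorsionClass 𝓔 Θ) (_ : U ∈ L) => U.obj)
        fun _ hU => hT hU⟩

end TorsionClass

namespace TorsionFreeClass

lemma obj_of_isZero (hΘ : IsLengthFunction 𝓔 Θ) (F : TorsionFreeClass 𝓔 Θ) {M : C}
    (hM : IsZero M) : F.obj M := by
  obtain ⟨X, hX⟩ := F.nonempty
  exact F.sub_le _ ⟨X, 0, hX, X, 𝟙 X, hΘ.isStable_zero_iso hM (Iso.refl X)⟩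

lemma rightOrthogonal_leftOrthogonal (hΘ : IsLengthCategory 𝓔 Θ) (F : TorsionFreeClass 𝓔 Θ) :
    F.obj.leftOrthogonal.rightOrthogonal = F.obj := by
  rw [← hΘ.filt_eq_rightOrthogonal_leftOrthogonal F.sub_le]
  exact le_antisymm (filt_le (fun _ => F.obj_of_isZero hΘ.isLengthFunction) F.star_le le_rfl)
    (le_filt hΘ.isLengthFunction _)

/-- The torsion-free class `S^⊥`, for `S` closed under `Θ`-quotients. -/
def ofRightOrthogonal (hΘ : IsLengthCategory 𝓔 Θ) (S : ObjectProperty C)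
    (hS : fac 𝓔 Θ S ≤ S) : TorsionFreeClass 𝓔 Θ where
  obj := S.rightOrthogonal
  nonempty := ⟨0, fun _ _ _ => (isZero_zero C).eq_of_tgt _ _⟩
  isClosedUnderIso := inferInstance
  sub_le := hΘ.sub_rightOrthogonal_le hS
  star_le := rightOrthogonal_star_le S

/-- The intersection of a set of torsion-free classes. -/
def inter (hΘ : IsLengthFunction 𝓔 Θ) (L : Set (TorsionFreeClass 𝓔 Θ)) :
    TorsionFreeClass 𝓔 Θ where
  obj := ⨅ F ∈ L, F.obj
  nonempty := ⟨0, by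
    simp only [iInf_apply, iInf_Prop_eq]
    exact fun F _ => F.obj_of_isZero hΘ (isZero_zero C)⟩
  isClosedUnderIso := ⟨fun e h => by
    simp only [iInf_apply, iInf_Prop_eq] at h ⊢
    exact fun F hF => F.isClosedUnderIso.of_iso e (h F hF)⟩
  sub_le := by
    rintro M ⟨X, y, hX, hy⟩
    simp only [iInf_apply, iInf_Prop_eq] at hX ⊢
    exact fun F hF => F.sub_le _ ⟨X, y, hX F hF, hy⟩
  star_le := by
    rintro M ⟨X, Y, x, y, hX, hY, h⟩
    simp only [iInf_apply, iInf_Prop_eq] at hX hY ⊢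
    exact fun F hF => F.star_le _ ⟨X, Y, x, y, hX F hF, hY F hF, h⟩

/-- The complete lattice of torsion-free classes, ordered by inclusion. -/
@[reducible]
def completeLattice (hΘ : IsLengthFunction 𝓔 Θ) : CompleteLattice (TorsionFreeClass 𝓔 Θ) :=
  letI : InfSet (TorsionFreeClass 𝓔 Θ) := ⟨inter hΘ⟩
  completeLatticeOfInf _ fun L =>
    ⟨fun _ hF => iInf₂_le (f := fun (G : TorsionFreeClass 𝓔 Θ) (_ : G ∈ L) => G.obj) _ hF,
      fun _ hF => le_iInf₂ (f := fun (G : TorsionFreeClass 𝓔 Θ) (_ : G ∈ L) => G.obj)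
        fun _ hG => hF hG⟩

end TorsionFreeClass

/-! ### Joins as filtration closures and double orthogonals. -/

lemma fac_biSup_le (L : Set (TorsionClass 𝓔 Θ)) :
    fac 𝓔 Θ (⨆ T ∈ L, T.obj) ≤ ⨆ T ∈ L, T.obj := by
  rintro M ⟨X, y, hX, hy⟩
  simp only [ObjectProperty.prop_iSup_iff] at hX ⊢
  obtain ⟨T, hT, hX⟩ := hX
  exact ⟨T, hT, T.fac_le _ ⟨X, y, hX, hy⟩⟩

lemma sub_biSup_le (L : Set (TorsionFreeClass 𝓔 Θ)) :
    sub 𝓔 Θ (⨆ F ∈ L, F.obj) ≤ ⨆ F ∈ L, F.obj := by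
  rintro M ⟨X, y, hX, hy⟩
  simp only [ObjectProperty.prop_iSup_iff] at hX ⊢
  obtain ⟨F, hF, hX⟩ := hX
  exact ⟨F, hF, F.sub_le _ ⟨X, y, hX, hy⟩⟩

namespace TorsionClass

lemma sSup_obj_eq_filt (hΘ : IsLengthCategory 𝓔 Θ) (L : Set (TorsionClass 𝓔 Θ)) :
    letI := completeLattice hΘ.isLengthFunction
    (sSup L).obj = filt 𝓔 Θ (⨆ T ∈ L, T.obj) := by
  let := completeLattice hΘ.isLengthFunction
  apply le_antisymm
  · rw [hΘ.filt_eq_leftOrthogonal_rightOrthogonal (fac_biSup_le L)]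
    -- The double orthogonal of the union is itself a torsion class and an upper bound of `L`.
    have h : sSup L ≤ ofLeftOrthogonal hΘ _ (hΘ.sub_rightOrthogonal_le (fac_biSup_le L)) :=
      sSup_le fun T hT => (le_iSup₂ (f := fun (U : TorsionClass 𝓔 Θ) (_ : U ∈ L) => U.obj)
        T hT).trans
        ((le_filt hΘ.isLengthFunction _).trans (filt_le_leftOrthogonal_rightOrthogonal _))
    exact h
  · exact filt_le (fun _ => obj_of_isZero hΘ.isLengthFunction _) (sSup L).star_le
      (iSup₂_le fun T hT => (le_sSup hT : T ≤ sSup L))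

lemma sSup_obj_eq_leftOrthogonal (hΘ : IsLengthCategory 𝓔 Θ) (L : Set (TorsionClass 𝓔 Θ)) :
    letI := completeLattice hΘ.isLengthFunction
    (sSup L).obj = (⨅ T ∈ L, T.obj.rightOrthogonal).leftOrthogonal := by
  rw [sSup_obj_eq_filt hΘ, hΘ.filt_eq_leftOrthogonal_rightOrthogonal (fac_biSup_le L),
    rightOrthogonal_biSup]

lemma sSup_rightOrthogonal (hΘ : IsLengthCategory 𝓔 Θ) (L : Set (TorsionClass 𝓔 Θ)) :
    letI := completeLattice hΘ.isLengthFunction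
    (sSup L).obj.rightOrthogonal = ⨅ T ∈ L, T.obj.rightOrthogonal := by
  rw [sSup_obj_eq_leftOrthogonal hΘ, ← rightOrthogonal_biSup]
  exact (TorsionFreeClass.ofRightOrthogonal hΘ _
    (fac_biSup_le L)).rightOrthogonal_leftOrthogonal hΘ

lemma inf_obj_iff (hΘ : IsLengthFunction 𝓔 Θ) (T U : TorsionClass 𝓔 Θ) (M : C) :
    letI := completeLattice hΘ
    (T ⊓ U).obj M ↔ T.obj M ∧ U.obj M := by
  let := completeLattice hΘ
  rw [← sInf_pair]
  change (⨅ V ∈ ({T, U} : Set (TorsionClass 𝓔 Θ)), V.obj) M ↔ _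
  rw [iInf_pair]
  rfl

lemma sup_rightOrthogonal_iff (hΘ : IsLengthCategory 𝓔 Θ) (T U : TorsionClass 𝓔 Θ) (M : C) :
    letI := completeLattice hΘ.isLengthFunction
    (T ⊔ U).obj.rightOrthogonal M ↔ T.obj.rightOrthogonal M ∧ U.obj.rightOrthogonal M := by
  let := completeLattice hΘ.isLengthFunction
  rw [← sSup_pair, sSup_rightOrthogonal hΘ, iInf_pair]
  rfl

lemma le_of_rightOrthogonal_le (hΘ : IsLengthCategory 𝓔 Θ) {T U : TorsionClass 𝓔 Θ}
    (h : U.obj.rightOrthogonal ≤ T.obj.rightOrthogonal) : T ≤ U := by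
  change T.obj ≤ U.obj
  rw [← U.leftOrthogonal_rightOrthogonal hΘ]
  exact fun M hM N f hN => h _ hN f hM

end TorsionClass

namespace TorsionFreeClass

lemma sSup_obj_eq_filt (hΘ : IsLengthCategory 𝓔 Θ) (L : Set (TorsionFreeClass 𝓔 Θ)) :
    letI := completeLattice hΘ.isLengthFunction
    (sSup L).obj = filt 𝓔 Θ (⨆ F ∈ L, F.obj) := by
  let := completeLattice hΘ.isLengthFunction
  apply le_antisymm
  · rw [hΘ.filt_eq_rightOrthogonal_leftOrthogonal (sub_biSup_le L)]
    have h : sSup L ≤ ofRightOrthogonal hΘ _ (hΘ.fac_leftOrthogonal_le (sub_biSup_le L)) :=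
      sSup_le fun F hF => (le_iSup₂ (f := fun (G : TorsionFreeClass 𝓔 Θ) (_ : G ∈ L) => G.obj)
        F hF).trans
        ((le_filt hΘ.isLengthFunction _).trans (filt_le_rightOrthogonal_leftOrthogonal _))
    exact h
  · exact filt_le (fun _ => obj_of_isZero hΘ.isLengthFunction _) (sSup L).star_le
      (iSup₂_le fun F hF => (le_sSup hF : F ≤ sSup L))

lemma sSup_obj_eq_rightOrthogonal (hΘ : IsLengthCategory 𝓔 Θ) (L : Set (TorsionFreeClass 𝓔 Θ)) :
    letI := completeLattice hΘ.isLengthFunction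
    (sSup L).obj = (⨅ F ∈ L, F.obj.leftOrthogonal).rightOrthogonal := by
  rw [sSup_obj_eq_filt hΘ, hΘ.filt_eq_rightOrthogonal_leftOrthogonal (sub_biSup_le L),
    leftOrthogonal_biSup]

end TorsionFreeClass

/-- The order-reversing bijection `T ↦ T^⊥` between torsion and torsion-free classes. -/
def torsionOrderIso (hΘ : IsLengthCategory 𝓔 Θ) :
    TorsionClass 𝓔 Θ ≃o (TorsionFreeClass 𝓔 Θ)ᵒᵈ where
  toFun T := OrderDual.toDual (TorsionFreeClass.ofRightOrthogonal hΘ T.obj T.fac_le)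
  invFun F := TorsionClass.ofLeftOrthogonal hΘ (OrderDual.ofDual F).obj (OrderDual.ofDual F).sub_le
  left_inv T := le_antisymm (T.leftOrthogonal_rightOrthogonal hΘ).le
    (T.leftOrthogonal_rightOrthogonal hΘ).ge
  right_inv F := le_antisymm (α := TorsionFreeClass 𝓔 Θ)
    ((OrderDual.ofDual F).rightOrthogonal_leftOrthogonal hΘ).le
    ((OrderDual.ofDual F).rightOrthogonal_leftOrthogonal hΘ).ge
  map_rel_iff' := ⟨TorsionClass.le_of_rightOrthogonal_le hΘ,
    fun h _ hM _ f hX => hM f (h _ hX)⟩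

/-! ### Semidistributivity and algebraicity -/

namespace TorsionClass

/-- A nonzero `M` in `T ⊓ sSup L` receives a nonzero `Θ`-inflation from some `I` in a member `V` of
`L`. By induction its cone lies in `T ⊓ U = T ⊓ V`, so `M` is an extension within `V`. It does not
matter whether `I` lies in `T`, since `M` does. -/
lemma inf_sSup_le (hΘ : IsLengthCategory 𝓔 Θ) (T : TorsionClass 𝓔 Θ)
    (L : Set (TorsionClass 𝓔 Θ)) :
    letI := completeLattice hΘ.isLengthFunction
    (∀ U ∈ L, ∀ V ∈ L, T ⊓ U = T ⊓ V) → ∀ U ∈ L, T ⊓ sSup L ≤ T ⊓ U := by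
  let := completeLattice hΘ.isLengthFunction
  intro hL U hU M hM
  induction hn : Θ M using Nat.strong_induction_on generalizing M with
  | h n ih =>
    subst hn
    obtain ⟨hMT, hML⟩ := (inf_obj_iff hΘ.isLengthFunction _ _ _).1 hM
    by_cases hM₀ : IsZero M
    · exact obj_of_isZero hΘ.isLengthFunction _ hM₀
    -- Otherwise `M` would lie both in `sSup L` and in its right orthogonal.
    obtain ⟨V, hV, hMV⟩ : ∃ V ∈ L, ¬ V.obj.rightOrthogonal M := by
      by_contra! h
      refine hM₀ (isZero_of_rightOrthogonal hML ?_)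
      rw [sSup_rightOrthogonal hΘ]
      simpa only [iInf_apply, iInf_Prop_eq] using h
    obtain ⟨I, j, hI, hI', N, c, hj⟩ := hΘ.exists_isInflation_of_not_rightOrthogonal V.fac_le hMV
    have h₁ := hj.2
    have h₂ : Θ I ≠ 0 := fun h => hI' ((hΘ.isLengthFunction.eq_zero_iff I).1 h)
    have hN := ih _ (by omega) N ((T ⊓ sSup L).fac_le _ ⟨M, c, hM, I, j, hj⟩) rfl
    rw [hL U hU V hV, inf_obj_iff] at hN ⊢
    exact ⟨hMT, V.star_le _ ⟨I, N, j, c, hI, hN.2, hj⟩⟩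

/-- After passing to right orthogonals, the dual induction applies: a nonzero quotient `I` in `V^⊥`
is split off, and the shorter kernel is handled by induction. -/
lemma le_sup_sInf (hΘ : IsLengthCategory 𝓔 Θ) (T : TorsionClass 𝓔 Θ)
    (L : Set (TorsionClass 𝓔 Θ)) :
    letI := completeLattice hΘ.isLengthFunction
    (∀ U ∈ L, ∀ V ∈ L, T ⊔ U = T ⊔ V) → ∀ U ∈ L, T ⊔ U ≤ T ⊔ sInf L := by
  let := completeLattice hΘ.isLengthFunction
  intro hL U hU
  refine le_of_rightOrthogonal_le hΘ fun M hM => ?_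
  induction hn : Θ M using Nat.strong_induction_on generalizing M with
  | h n ih =>
    subst hn
    obtain ⟨hMT, hML⟩ := (sup_rightOrthogonal_iff hΘ _ _ _).1 hM
    by_cases hM₀ : IsZero M
    · exact fun _ _ _ => hM₀.eq_of_tgt _ _
    obtain ⟨V, hV, hMV⟩ : ∃ V ∈ L, ¬ V.obj M := by
      by_contra! h
      refine hM₀ (isZero_of_rightOrthogonal ?_ hML)
      change (⨅ V ∈ L, V.obj) M
      simpa only [iInf_apply, iInf_Prop_eq] using h
    rw [← V.leftOrthogonal_rightOrthogonal hΘ] at hMV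
    obtain ⟨I, i, hI, hI', N, k, hi⟩ := hΘ.exists_isDeflation_of_not_leftOrthogonal
      (hΘ.sub_rightOrthogonal_le V.fac_le) hMV
    have h₁ := hi.2
    have h₂ : Θ I ≠ 0 := fun h => hI' ((hΘ.isLengthFunction.eq_zero_iff I).1 h)
    have hN := ih _ (by omega) N
      (hΘ.sub_rightOrthogonal_le (T ⊔ sInf L).fac_le _ ⟨M, k, hM, I, i, hi⟩) rfl
    rw [hL U hU V hV, sup_rightOrthogonal_iff hΘ] at hN ⊢
    exact ⟨hMT, rightOrthogonal_star_le _ _ ⟨N, I, k, i, hN.2, hI, hi⟩⟩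

lemma isCompletelySemidistributive (hΘ : IsLengthCategory 𝓔 Θ) :
    letI := completeLattice hΘ.isLengthFunction
    IsCompletelySemidistributive (TorsionClass 𝓔 Θ) := by
  let := completeLattice hΘ.isLengthFunction
  exact fun T L =>
    ⟨fun h U hU => (inf_sSup_le hΘ T L h U hU).antisymm (inf_le_inf_left T (le_sSup hU)),
      fun h U hU => (sup_le_sup_left (sInf_le hU) T).antisymm (le_sup_sInf hΘ T L h U hU)⟩

/-- Every torsion class is the join of the torsion classes generated by its objects, and these
are compact. -/
lemma isAlgebraicLattice (hΘ : IsLengthCategory 𝓔 Θ) :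
    letI := completeLattice hΘ.isLengthFunction
    IsAlgebraicLattice (TorsionClass 𝓔 Θ) := by
  let := completeLattice hΘ.isLengthFunction
  have mem (M : C) : (sInf {U : TorsionClass 𝓔 Θ | U.obj M}).obj M := by
    change (⨅ V ∈ {U : TorsionClass 𝓔 Θ | U.obj M}, V.obj) M
    simp only [iInf_apply, iInf_Prop_eq]
    exact fun _ h => h
  intro T
  let K : Set (TorsionClass 𝓔 Θ) := {U | ∃ M, T.obj M ∧ U = sInf {V | V.obj M}}
  refine ⟨K, le_antisymm ?_ ?_, ?_⟩
  · intro M hM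
    have h : sInf {V : TorsionClass 𝓔 Θ | V.obj M} ≤ sSup K := le_sSup ⟨M, hM, rfl⟩
    exact h _ (mem M)
  · refine sSup_le ?_
    rintro _ ⟨M, hM, rfl⟩
    exact sInf_le hM
  · rintro _ ⟨M, hM, rfl⟩ L hL
    -- Compactness: `M` has a filtration by members of `L`, which uses only finitely many of them.
    have h := hL _ (mem M)
    rw [sSup_obj_eq_filt hΘ] at h
    obtain ⟨S, hSL, hS, h⟩ := filt_biSup_finite h
    rw [← sSup_obj_eq_filt hΘ] at h
    exact ⟨S, hSL, hS, sInf_le h⟩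

end TorsionClass

end Lattice

end Extri

theorem theorem4 {C : Type u} [Category.{v} C] [Preadditive C] [HasZeroObject C]
    [HasBinaryBiproducts C]
    (𝓔 : Extri.ExtriangulatedStructure.{w} C) (Θ : C → ℕ)
    (hΘ : Extri.IsLengthCategory 𝓔 Θ) :
    ∃ (_ : CompleteLattice (Extri.TorsionClass 𝓔 Θ))
      (_ : CompleteLattice (Extri.TorsionFreeClass 𝓔 Θ)),
      -- the orders are the inclusions
      (∀ T U : Extri.TorsionClass 𝓔 Θ, T ≤ U ↔ T.obj ≤ U.obj) ∧
      (∀ F G : Extri.TorsionFreeClass 𝓔 Θ, F ≤ G ↔ F.obj ≤ G.obj) ∧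
      -- joins and meets of torsion classes
      (∀ L : Set (Extri.TorsionClass 𝓔 Θ),
        (sSup L).obj = (⨅ T ∈ L, T.obj.rightOrthogonal).leftOrthogonal ∧
        (sSup L).obj = Extri.filt 𝓔 Θ (⨆ T ∈ L, T.obj) ∧
        (sInf L).obj = ⨅ T ∈ L, T.obj) ∧
      -- joins and meets of torsion-free classes
      (∀ L : Set (Extri.TorsionFreeClass 𝓔 Θ),
        (sSup L).obj = (⨅ F ∈ L, F.obj.leftOrthogonal).rightOrthogonal ∧
        (sSup L).obj = Extri.filt 𝓔 Θ (⨆ F ∈ L, F.obj) ∧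
        (sInf L).obj = ⨅ F ∈ L, F.obj) ∧
      -- the isomorphism of complete lattices `T ↦ T^⊥`
      (∃ e : Extri.TorsionClass 𝓔 Θ ≃o (Extri.TorsionFreeClass 𝓔 Θ)ᵒᵈ,
        (∀ T, (OrderDual.ofDual (e T)).obj = T.obj.rightOrthogonal) ∧
        (∀ L, e (sSup L) = sSup (e '' L)) ∧ (∀ L, e (sInf L) = sInf (e '' L))) ∧
      Extri.IsCompletelySemidistributive (Extri.TorsionClass 𝓔 Θ) ∧
      Extri.IsAlgebraicLattice (Extri.TorsionClass 𝓔 Θ) := by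
  let := Extri.TorsionClass.completeLattice hΘ.isLengthFunction
  let := Extri.TorsionFreeClass.completeLattice hΘ.isLengthFunction
  exact ⟨inferInstance, inferInstance, fun _ _ => Iff.rfl, fun _ _ => Iff.rfl,
    fun L => ⟨Extri.TorsionClass.sSup_obj_eq_leftOrthogonal hΘ L,
      Extri.TorsionClass.sSup_obj_eq_filt hΘ L, rfl⟩,
    fun L => ⟨Extri.TorsionFreeClass.sSup_obj_eq_rightOrthogonal hΘ L,
      Extri.TorsionFreeClass.sSup_obj_eq_filt hΘ L, rfl⟩,
    ⟨Extri.torsionOrderIso hΘ, fun _ => rfl,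
      fun L => by rw [OrderIso.map_sSup, sSup_image],
      fun L => by rw [OrderIso.map_sInf, sInf_image]⟩,
    Extri.TorsionClass.isCompletelySemidistributive hΘ,
    Extri.TorsionClass.isAlgebraicLattice hΘ⟩
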